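/- Let $(\Omega,\mathcal F,P)$ be a probability space, $E$ a complete separable metric space, and $\xi:[0,\infty)\times\Omega\to E$ a stochastic process whose paths are RCLL (right continuous with left limits); let $\mathcal F^\xi_t=\sigma(\xi_s:s\le t)$. Let $X:[0,\infty)\times\Omega\to\mathbb R$ be an $\{\mathcal F^\xi_t\}$-progressively measurable process whose paths are RCLL and of bounded variation on compact intervals. Let $\alpha>0$ and $t_0\ge 0$. For an $\mathcal F^\xi_{t_0}$-measurable $Z:\Omega\to\mathbb R$ consider the initial value problem $$dY_t=e^{-\alpha t}\,dX_t\quad(t\in[t_0,\infty)),\qquad Y_{t_0}=Z,$$ that is, pathwise, $Y_{t_0}=Z$ and $Y_t-Y_{t_0}=\int_{(t_0,t]}e^{-\alpha s}\,dX_s$ for all $t\ge t_0$ (Lebesgue--Stieltjes integral). Then for every such $Z$ there is a solution $Y^{(Z)}$, which is pathwise unique on $[t_0,\infty)$, and $Y^{(Z)}_t$ is $\mathcal F^\xi_t$-measurable for $t\ge t_0$. Moreover, for every $t\ge t_0$, $$\mathbb E^P\big[f(Y^{(Z)}_t)\,\big|\,\mathcal F^\xi_{t_0}\big]=\mathbb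 E^P\big[f(Y^{(z)}_t)\,\big|\,\mathcal F^\xi_{t_0}\big]\Big|_{z=Z}\qquad P\text{-a.s.}$$ for all bounded measurable $f:\mathbb R\to\mathbb R$ and all $\mathcal F^\xi_{t_0}$-measurable $Z:\Omega\to\mathbb R$, where the versions to be evaluated at $z=Z$ are regular ones, in the following sense. (a) There is a Markov kernel $Q$ from $(\mathbb R\times\Omega,\mathcal B(\mathbb R)\otimes\mathcal F^\xi_{t_0})$ to $\mathbb R$ such that, for all bounded measurable $f$, all $z\in\mathbb R$ and all $\mathcal F^\xi_{t_0}$-measurable $Z$, $P$-a.s. $$\mathbb E^P[f(Y^{(z)}_t)|\mathcal F^\xi_{t_0}](\omega)=\int f(y)\,Q((z,\omega),dy),\qquad \mathbb E^P[f(Y^{(Z)}_t)|\mathcal F^\xi_{t_0}](\omega)=\int f(y)\,Q((Z(\omega),\omega),dy).$$ (b) If $\kappa$ is any regular conditional probability on $(\Omega,\mathcal F)$ under $P$ given $\mathcal F^\xi_{t_0}$, then for all $f,z,Z$ as in (a), $P$-a.s. $$\mathbb E^P[f(Y^{(z)}_t)|\mathcal F^\xi_{t_0}](\omega)=\int f(Y^{(z)}_t(\omega'))\,\kappa(\omega,d\omega'),\qquad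 \mathbb E^P[f(Y^{(Z)}_t)|\mathcal F^\xi_{t_0}](\omega)=\int f(Y^{(Z(\omega))}_t(\omega'))\,\kappa(\omega,d\omega').$$ -/

import Mathlib

open MeasureTheory ProbabilityTheory Set Filter Topology
open scoped NNReal ENNReal

namespace QuasiMarkov

/-- A path `x : [0,∞) → E` is RCLL if it is right continuous and has left limits.
(At `t = 0` the left limit condition is void.) -/
structure IsRCLL {E : Type*} [TopologicalSpace E] (x : ℝ≥0 → E) : Prop where
  right_continuous : ∀ t, ContinuousWithinAt x (Ici t) t
  left_limits : ∀ t, ∃ l, Tendsto x (𝓝[<] t) (𝓝 l)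

/-- A path of bounded variation on the compact subintervals of `[0,∞)`, stopped at time `b`,
has bounded variation on the whole of `[0,∞)`. -/
theorem boundedVariationOn_stopped {x : ℝ≥0 → ℝ} (hx : LocallyBoundedVariationOn x univ)
    (b : ℝ≥0) : BoundedVariationOn (fun s => x (min s b)) univ := by
  have h1 : eVariationOn (x ∘ fun s => min s b) univ ≤ eVariationOn x (univ ∩ Icc 0 b) := by
    apply eVariationOn.comp_le_of_monotoneOn
    · intro s _ t _ hst
      exact min_le_min_right b hst
    · intro s _
      exact ⟨mem_univ _, zero_le, min_le_right _ _⟩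
  exact ne_top_of_le_ne_top (hx 0 b (mem_univ _) (mem_univ _)) h1

/-- The Lebesgue--Stieltjes integral `∫_{(a,b]} g(s) dx(s)` along a (right continuous) path `x` of
bounded variation on compact intervals: the integral of `g` over `(a,b]` against the signed
measure `dx`, which gives mass `x v - x u` to every interval `(u,v] ⊆ (a,b]`.
(On `[0,b]` the path `x` agrees with the path stopped at `b`, whose signed measure is finite.) -/
noncomputable def stieltjesIntegral (g : ℝ≥0 → ℝ) {x : ℝ≥0 → ℝ}
    (hx : LocallyBoundedVariationOn x univ) (a b : ℝ≥0) : ℝ :=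
  ∫ᵛ s in Ioc a b, g s ∂•(boundedVariationOn_stopped hx b).vectorMeasure

/-- `Y` is a (pathwise) solution of `dY_t = e^{-αt} dX_t`, `t ∈ [t₀,∞)`, `Y_{t₀} = Z`, where the
paths of `X` have bounded variation on compact intervals. Only the values `Y_t` with
`t ≥ t₀` matter. -/
structure IsSolution {Ω : Type*} (α : ℝ) (t₀ : ℝ≥0) {X : ℝ≥0 → Ω → ℝ}
    (hX : ∀ ω, LocallyBoundedVariationOn (fun s => X s ω) univ)
    (Z : Ω → ℝ) (Y : ℝ≥0 → Ω → ℝ) : Prop where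
  initial : ∀ ω, Y t₀ ω = Z ω
  equation : ∀ ω, ∀ t, t₀ ≤ t →
    Y t ω - Y t₀ ω = stieltjesIntegral (fun s => Real.exp (-α * (s : ℝ))) (hX ω) t₀ t

/-- `κ` is a regular conditional probability on `(Ω, mΩ)` under `P` given the
sub-`σ`-algebra `m`: a Markov kernel from `(Ω, m)` to `(Ω, mΩ)` such that, for every event `A`,
`κ(·, A)` is a version of `P(A | m)`. -/
structure IsRegularCondProb {Ω : Type*} {mΩ : MeasurableSpace Ω} (P : Measure Ω)
    (m : MeasurableSpace Ω) (κ : @Kernel Ω Ω m mΩ) : Prop where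
  isMarkov : ∀ ω, IsProbabilityMeasure (κ ω)
  condProb : ∀ A, MeasurableSet[mΩ] A →
    P[A.indicator (fun _ => (1 : ℝ)) | m] =ᵐ[P] fun ω => (κ ω).real A

end QuasiMarkov

namespace QuasiMarkov

/-! The right-hand side of the equation does not involve `Y`, so every solution is `Z + W t`, where
`W t` is the pathwise integral over `(t₀, t]` and is the same for all `Z`. Existence and uniqueness
are then immediate, and two things remain. Measurability of `W t`: the signed measure `dX` on `(t₀,
t]` depends measurably on `ω`, setwise by a π-λ argument, hence so do its integrals
(`measurable_stieltjesIntegral`). Substitution: given `F t₀` the value of `Z` is frozen and only `W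
t` is averaged, by the disintegration of the joint law of (`id`, `W t`). -/

theorem isFiniteMeasure_variation_signedMeasure {S : Type*} [MeasurableSpace S]
    (μ : SignedMeasure S) : IsFiniteMeasure μ.variation := by
  rw [← SignedMeasure.totalVariation_eq_variation, SignedMeasure.totalVariation]
  infer_instance

/-- If a family of signed measures depends measurably on a parameter, setwise, then so does the
integral of a fixed bounded measurable function. -/
theorem measurable_integral_signedMeasure {Ω S : Type*} [MeasurableSpace S]
    {m : MeasurableSpace Ω} {ν : Ω → SignedMeasure S}
    (hν : ∀ s, MeasurableSet s → Measurable fun ω => ν ω s)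
    {g : S → ℝ} (hg : Measurable g) {C : ℝ} (hC : ∀ s, |g s| ≤ C) :
    Measurable fun ω => ∫ᵛ s, g s ∂•(ν ω) := by
  have hfin ω := isFiniteMeasure_variation_signedMeasure (ν ω)
  classical
  have hsimple (φ : SimpleFunc S ℝ) : Measurable fun ω => ∫ᵛ s, φ s ∂•(ν ω) := by
    induction φ using SimpleFunc.induction with
    | const c hs =>
      rename_i s
      have h ω : ∫ᵛ x, (SimpleFunc.piecewise s hs (SimpleFunc.const _ c)
          (SimpleFunc.const _ 0)) x ∂•(ν ω) = c * ν ω s := by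
        rw [SimpleFunc.coe_piecewise, SimpleFunc.coe_const, SimpleFunc.coe_const,
          show (Function.const S (0 : ℝ)) = 0 from rfl, piecewise_eq_indicator,
          VectorMeasure.integral_indicator hs]
        simp
      simp_rw [h]
      exact (hν s hs).const_mul c
    | add hd hf hg =>
      rename_i f g
      have h ω : ∫ᵛ x, (f + g) x ∂•(ν ω) = ∫ᵛ x, f x ∂•(ν ω) + ∫ᵛ x, g x ∂•(ν ω) :=
        VectorMeasure.integral_add (SimpleFunc.integrable_of_isFiniteMeasure f)
          (SimpleFunc.integrable_of_isFiniteMeasure g)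
      simp_rw [h]
      exact hf.add hg
  refine measurable_of_tendsto_metrizable
    (fun n => hsimple (SimpleFunc.approxOn g hg univ 0 (mem_univ _) n))
    (tendsto_pi_nhds.2 fun ω => ?_)
  -- Approximants built from the base point `0` are bounded by `2|g|`, hence the constant `C + C`.
  refine VectorMeasure.tendsto_integral_of_dominated_convergence (fun _ => C + C)
    (fun n => (SimpleFunc.measurable _).aestronglyMeasurable) (integrable_const _)
    (fun n => ae_of_all _ fun s => ?_) (ae_of_all _ fun s => ?_)
  · exact (SimpleFunc.norm_approxOn_zero_le hg (mem_univ _) s n).trans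
      (add_le_add (hC s) (hC s))
  · exact SimpleFunc.tendsto_approxOn hg (mem_univ _) (by simp)

/-- The measure of an interval is a difference of right limits; stopping preserves right continuity,
so these are values of the path. -/
theorem stopped_vectorMeasure_Ioc {x : ℝ≥0 → ℝ} (hx : LocallyBoundedVariationOn x univ)
    (hr : ∀ t, ContinuousWithinAt x (Ici t) t) (b : ℝ≥0) {u v : ℝ≥0} (huv : u ≤ v) :
    (boundedVariationOn_stopped hx b).vectorMeasure (Ioc u v) = x (min v b) - x (min u b) := by
  have hlim t : Function.rightLim (fun s => x (min s b)) t = x (min t b) := by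
    refine ContinuousWithinAt.rightLim_eq ?_
    refine (hr (min t b)).comp (t := Ici (min t b)) (f := fun s => min s b) ?_ ?_
    · fun_prop
    · intro s hs
      exact min_le_min_right b hs
  rw [BoundedVariationOn.vectorMeasure_Ioc _ huv, hlim, hlim]

theorem measurable_stieltjesIntegral {Ω : Type*} {m : MeasurableSpace Ω} {X : ℝ≥0 → Ω → ℝ}
    (hX : ∀ ω, LocallyBoundedVariationOn (fun s => X s ω) univ)
    (hr : ∀ ω t, ContinuousWithinAt (fun s => X s ω) (Ici t) t) {a b : ℝ≥0}
    (hm : ∀ s ≤ b, Measurable (X s))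
    {g : ℝ≥0 → ℝ} (hg : Measurable g) {C : ℝ} (hC : ∀ s, |g s| ≤ C) :
    Measurable fun ω => stieltjesIntegral g (hX ω) a b := by
  refine measurable_integral_signedMeasure (fun s hs => ?_) hg hC
  have hIoc u v : Measurable fun ω =>
      (boundedVariationOn_stopped (hX ω) b).vectorMeasure (Ioc u v) := by
    rcases le_or_gt u v with huv | huv
    · simp_rw [fun ω => stopped_vectorMeasure_Ioc (hX ω) (hr ω) b huv]
      exact (hm _ (min_le_right _ _)).sub (hm _ (min_le_right _ _))
    · simp [Ioc_eq_empty huv.not_gt]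
  -- The half-lines `Iic v` form a generating π-system whose traces on `(a, b]` are intervals, so
  -- only values of `X` up to time `b` enter.
  induction s, hs using MeasurableSpace.induction_on_inter
    ((BorelSpace.measurable_eq (α := ℝ≥0)).trans (borel_eq_generateFrom_Iic ℝ≥0))
    isPiSystem_Iic with
  | empty => simp
  | basic s hs =>
    obtain ⟨v, rfl⟩ := hs
    have h : Iic v ∩ Ioc a b = Ioc a (min b v) := by
      ext; simp; tauto
    simpa [VectorMeasure.restrict_apply, h] using hIoc a (min b v)
  | compl s hs ih =>
    simp_rw [VectorMeasure.of_compl hs]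
    exact Measurable.sub (by simpa using hIoc a b) ih
  | iUnion f hd hf ih =>
    refine measurable_of_tendsto_metrizable (fun n => Finset.measurable_sum (Finset.range n)
      fun i _ => ih i) (tendsto_pi_nhds.2 fun ω => ?_)
    simpa using (VectorMeasure.hasSum_of_disjoint_iUnion hf hd).tendsto_sum_nat


section Conditioning

variable {Ω β : Type*} [MeasurableSpace Ω] {mβ : MeasurableSpace β} {P : Measure Ω}
  [IsProbabilityMeasure P] {X : Ω → β} {W : Ω → ℝ}

/-- A kernel `κ` with `κ (X ω)` a regular conditional probability given `σ(X)` has as image under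
`W` the conditional distribution of `W` given `X`. -/
theorem condDistrib_ae_eq_map_of_condProb (hX : Measurable X) (hW : Measurable W)
    (κ : Kernel β Ω) [IsMarkovKernel κ]
    (hκ : ∀ A, MeasurableSet A → P[A.indicator (fun _ => (1 : ℝ)) | mβ.comap X] =ᵐ[P]
      fun ω => (κ (X ω)).real A) :
    condDistrib W X P =ᵐ[P.map X] κ.map W := by
  have : IsMarkovKernel (κ.map W) := Kernel.IsMarkovKernel.map κ hW
  have : IsProbabilityMeasure (P.map fun ω => (X ω, W ω)) :=
    Measure.isProbabilityMeasure_map (by fun_prop)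
  -- It suffices to compare the joint laws on rectangles `s × t`, which is `hκ` for the event `W ⁻¹'
  -- t`, integrated over `X ⁻¹' s`.
  refine condDistrib_ae_eq_of_measure_eq_compProd X hW.aemeasurable (Measure.ext_prod ?_)
  intro s t hs ht
  have hA : MeasurableSet (W ⁻¹' t) := hW ht
  have hint := setIntegral_condExp (m := mβ.comap X) hX.comap_le
    ((integrable_const (μ := P) (1 : ℝ)).indicator hA) ⟨s, hs, rfl⟩
  rw [setIntegral_congr_ae (hX.comap_le _ ⟨s, hs, rfl⟩) ((hκ _ hA).mono fun ω h _ => h)] at hint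
  rw [Measure.map_apply (by fun_prop) (hs.prod ht), Measure.compProd_apply_prod hs ht,
    setLIntegral_map hs (Kernel.measurable_coe _ ht) hX]
  simp_rw [Kernel.map_apply' κ hW _ ht]
  have hfin : ∫⁻ ω in X ⁻¹' s, κ (X ω) (W ⁻¹' t) ∂P ≠ ∞ :=
    ne_top_of_le_ne_top (by simp) (lintegral_mono fun ω => prob_le_one (μ := κ (X ω)))
  rw [mk_preimage_prod, ← ENNReal.toReal_eq_toReal_iff' (measure_ne_top _ _) hfin,
    ← integral_toReal (f := fun ω => κ (X ω) (W ⁻¹' t))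
      ((κ.measurable_coe hA).comp hX).aemeasurable (ae_of_all _ fun ω => measure_lt_top _ _)]
  refine Eq.trans ?_ hint.symm
  rw [setIntegral_indicator hA]
  simp [measureReal_def]

theorem condExp_prod_ae_eq_integral_of_condProb (hX : Measurable X) (hW : Measurable W)
    (κ : Kernel β Ω) [IsMarkovKernel κ]
    (hκ : ∀ A, MeasurableSet A → P[A.indicator (fun _ => (1 : ℝ)) | mβ.comap X] =ᵐ[P]
      fun ω => (κ (X ω)).real A)
    {h : β × ℝ → ℝ} (hh : Measurable h) {C : ℝ} (hC : ∀ p, |h p| ≤ C) :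
    P[fun ω => h (X ω, W ω) | mβ.comap X] =ᵐ[P] fun ω => ∫ ω', h (X ω, W ω') ∂(κ (X ω)) := by
  have hint : Integrable (fun ω => h (X ω, W ω)) P :=
    Integrable.of_bound (hh.comp (hX.prodMk hW)).aestronglyMeasurable C (ae_of_all _ fun ω => hC _)
  filter_upwards [condExp_prod_ae_eq_integral_condDistrib hX hW.aemeasurable
    hh.stronglyMeasurable hint,
    ae_of_ae_map hX.aemeasurable (condDistrib_ae_eq_map_of_condProb hX hW κ hκ)] with ω h1 h2
  rw [h1, h2, Kernel.map_apply κ hW]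
  exact integral_map hW.aemeasurable (hh.comp measurable_prodMk_left).aestronglyMeasurable

/-- The kernel sending `(z, x)` to the law of `z + y`, where `y` has law `R x`. -/
noncomputable def translatedKernel (R : Kernel β ℝ) : Kernel (ℝ × β) ℝ :=
  (Kernel.deterministic (Prod.fst : ℝ × β → ℝ) measurable_fst ×ₖ
    R.comap Prod.snd measurable_snd).map fun p => p.1 + p.2

theorem translatedKernel_apply (R : Kernel β ℝ) [IsSFiniteKernel R] (z : ℝ) (x : β) :
    translatedKernel R (z, x) = (R x).map fun y => z + y := by
  rw [translatedKernel, Kernel.map_apply _ (by fun_prop), Kernel.prod_apply,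
    Kernel.deterministic_apply, Kernel.comap_apply, Measure.dirac_prod,
    Measure.map_map (by fun_prop) (by fun_prop)]
  rfl

/-- Disintegration is applied to the joint function `f (Z x + y)`, so one null set serves; no
uncountable union over the values `z` arises. -/
theorem condExp_prod_comp_add_ae_eq (hX : Measurable X) (hW : Measurable W)
    {Z : β → ℝ} (hZ : Measurable Z) {f : ℝ → ℝ} (hf : Measurable f) {C : ℝ}
    (hC : ∀ y, |f y| ≤ C) :
    P[fun ω => f (Z (X ω) + W ω) | mβ.comap X] =ᵐ[P]
      fun ω => ∫ y, f y ∂(translatedKernel (condDistrib W X P) (Z (X ω), X ω)) := by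
  have hh : Measurable fun p : β × ℝ => f (Z p.1 + p.2) := by fun_prop
  have hint : Integrable (fun ω => f (Z (X ω) + W ω)) P :=
    Integrable.of_bound (hh.comp (hX.prodMk hW)).aestronglyMeasurable C (ae_of_all _ fun ω => hC _)
  filter_upwards [condExp_prod_ae_eq_integral_condDistrib hX hW.aemeasurable
    hh.stronglyMeasurable hint] with ω h
  rw [h, translatedKernel_apply, integral_map (by fun_prop) hf.aestronglyMeasurable]

end Conditioning

end QuasiMarkov

theorem mainTheorem8 {Ω E : Type*} [MeasurableSpace Ω] (P : Measure Ω) [IsProbabilityMeasure P]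
    [MetricSpace E] [CompleteSpace E] [SecondCountableTopology E]
    [MeasurableSpace E] [BorelSpace E]
    (ξ : ℝ≥0 → Ω → E) (hξ : ∀ t, Measurable (ξ t))
    (hξ_rcll : ∀ ω, QuasiMarkov.IsRCLL (fun t => ξ t ω))
    (F : Filtration ℝ≥0 ‹MeasurableSpace Ω›)
    (hF : F = Filtration.natural ξ (fun t => (hξ t).stronglyMeasurable))
    (X : ℝ≥0 → Ω → ℝ) (hX_prog : IsProgressive F X)
    (hX_rcll : ∀ ω, QuasiMarkov.IsRCLL (fun t => X t ω))
    (hX_bv : ∀ ω, LocallyBoundedVariationOn (fun t => X t ω) univ)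
    (α : ℝ) (hα : 0 < α) (t₀ : ℝ≥0) :
    -- for every initial value, the problem has a solution, and it is pathwise unique on `[t₀,∞)`
    (∀ Z : Ω → ℝ, Measurable[F t₀] Z →
      (∃ Y, QuasiMarkov.IsSolution α t₀ hX_bv Z Y) ∧
      ∀ Y Y', QuasiMarkov.IsSolution α t₀ hX_bv Z Y → QuasiMarkov.IsSolution α t₀ hX_bv Z Y' →
        ∀ t, t₀ ≤ t → ∀ ω, Y t ω = Y' t ω) ∧
    -- `Y Z` denotes the solution with initial value `Z`
    ∀ Y : (Ω → ℝ) → ℝ≥0 → Ω → ℝ,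
      (∀ Z : Ω → ℝ, Measurable[F t₀] Z → QuasiMarkov.IsSolution α t₀ hX_bv Z (Y Z)) →
      ∀ t, t₀ ≤ t →
        (∀ Z : Ω → ℝ, Measurable[F t₀] Z → Measurable[F t] (Y Z t)) ∧
        -- the conditional laws of `Y_t^{(z)}` given `F t₀` have versions `Q (z, ·)`, jointly
        -- measurable in `(z, ω)`, for which the substitution `z = Z` is correct
        (∃ Q : @Kernel (ℝ × Ω) ℝ (MeasurableSpace.prod inferInstance (F t₀)) inferInstance,
          (∀ p, IsProbabilityMeasure (Q p)) ∧
          ∀ f : ℝ → ℝ, Measurable f → (∃ C, ∀ y, |f y| ≤ C) →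
            (∀ z : ℝ, P[fun ω => f (Y (fun _ => z) t ω) | F t₀] =ᵐ[P]
              fun ω => ∫ y, f y ∂(Q (z, ω))) ∧
            ∀ Z : Ω → ℝ, Measurable[F t₀] Z →
              P[fun ω => f (Y Z t ω) | F t₀] =ᵐ[P] fun ω => ∫ y, f y ∂(Q (Z ω, ω))) ∧
        -- the substitution is also correct for the versions computed from any regular
        -- conditional probability given `F t₀`
        ∀ κ : @Kernel Ω Ω (F t₀) ‹MeasurableSpace Ω›,
          QuasiMarkov.IsRegularCondProb P (F t₀) κ →
          ∀ f : ℝ → ℝ, Measurable f → (∃ C, ∀ y, |f y| ≤ C) →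
            (∀ z : ℝ, P[fun ω => f (Y (fun _ => z) t ω) | F t₀] =ᵐ[P]
              fun ω => ∫ ω', f (Y (fun _ => z) t ω') ∂(κ ω)) ∧
            ∀ Z : Ω → ℝ, Measurable[F t₀] Z →
              P[fun ω => f (Y Z t ω) | F t₀] =ᵐ[P]
                fun ω => ∫ ω', f (Y (fun _ => Z ω) t ω') ∂(κ ω) := by
  set W : ℝ≥0 → Ω → ℝ := fun t ω =>
    QuasiMarkov.stieltjesIntegral (fun s => Real.exp (-α * (s : ℝ))) (hX_bv ω) t₀ t with hW_def
  have hsol {Z Y} (h : QuasiMarkov.IsSolution α t₀ hX_bv Z Y) {t} (ht : t₀ ≤ t) (ω) :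
      Y t ω = Z ω + W t ω := by
    rw [← h.initial ω]
    exact eq_add_of_sub_eq' (h.equation ω t ht)
  have hWm t : Measurable[F t] (W t) :=
    QuasiMarkov.measurable_stieltjesIntegral (m := F t) hX_bv
      (fun ω => (hX_rcll ω).right_continuous)
      (fun s hs => (hX_prog.adapted s).mono (F.mono hs) le_rfl) (by fun_prop) (C := 1)
      fun s => by
        rw [Real.abs_exp, Real.exp_le_one_iff, neg_mul, neg_nonpos]
        positivity
  refine ⟨fun Z hZ => ⟨⟨fun t ω => Z ω + W t ω, ?_, ?_⟩, fun Y Y' hY hY' t ht ω => ?_⟩,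
    fun Y hY t ht => ⟨fun Z hZ => ?_, ?_, fun κ hκ f hf ⟨C, hC⟩ => ?_⟩⟩
  -- At `t = t₀` the integral runs over the empty interval `(t₀, t₀]`.
  · intro ω
    simp [hW_def, QuasiMarkov.stieltjesIntegral]
  · intro ω t ht
    simp [hW_def, QuasiMarkov.stieltjesIntegral]
  · rw [hsol hY ht, hsol hY' ht]
  · rw [funext (hsol (hY Z hZ) ht)]
    exact (hZ.mono (F.mono ht) le_rfl).add (hWm t)
  · have hW : Measurable (W t) := (hWm t).mono (F.le t) le_rfl
    -- Regarded as a map into `(Ω, F t₀)`, the identity generates exactly `F t₀`, so conditioning on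
    -- `F t₀` is conditioning on a random variable.
    have hX : Measurable[_, F t₀] (id : Ω → Ω) := measurable_id'' (F.le t₀)
    -- Only the target `ℝ` must be standard Borel, so `R` exists even if `Ω` admits no regular
    -- conditional probability.
    let R : @Kernel Ω ℝ (F t₀) _ := @condDistrib Ω Ω ℝ _ _ _ _ (F t₀) (W t) id P _
    have hR : @IsMarkovKernel _ _ (F t₀) _ R := by
      unfold R
      infer_instance
    refine ⟨QuasiMarkov.translatedKernel (mβ := F t₀) R, ?_, fun f hf ⟨C, hC⟩ => ?_⟩
    · rintro ⟨z, ω⟩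
      rw [QuasiMarkov.translatedKernel_apply]
      exact Measure.isProbabilityMeasure_map (by fun_prop)
    -- A deterministic `z` is the special case of a constant `Z`.
    suffices h : ∀ Z : Ω → ℝ, Measurable[F t₀] Z → P[fun ω => f (Y Z t ω) | F t₀] =ᵐ[P]
        fun ω => ∫ y, f y ∂(QuasiMarkov.translatedKernel (mβ := F t₀) R (Z ω, ω)) from
      ⟨fun z => h _ (@measurable_const _ _ _ (F t₀) z), h⟩
    intro Z hZ
    have key := QuasiMarkov.condExp_prod_comp_add_ae_eq (mβ := F t₀) (P := P) hX hW hZ hf hC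
    rw [MeasurableSpace.comap_id] at key
    simp_rw [hsol (hY Z hZ) ht]
    exact key
  · have hW : Measurable (W t) := (hWm t).mono (F.le t) le_rfl
    have hX : Measurable[_, F t₀] (id : Ω → Ω) := measurable_id'' (F.le t₀)
    have hκM : @IsMarkovKernel _ _ (F t₀) _ κ := @IsMarkovKernel.mk _ _ (F t₀) _ κ hκ.isMarkov
    suffices h : ∀ Z : Ω → ℝ, Measurable[F t₀] Z → P[fun ω => f (Y Z t ω) | F t₀] =ᵐ[P]
        fun ω => ∫ ω', f (Y (fun _ => Z ω) t ω') ∂(κ ω) from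
      ⟨fun z => h _ (@measurable_const _ _ _ (F t₀) z), h⟩
    intro Z hZ
    have key := QuasiMarkov.condExp_prod_ae_eq_integral_of_condProb (mβ := F t₀) (P := P) hX hW κ
      (by rw [MeasurableSpace.comap_id]; exact hκ.condProb) (h := fun p => f (Z p.1 + p.2))
      (hf.comp ((hZ.comp measurable_fst).add measurable_snd)) fun p => hC _
    rw [MeasurableSpace.comap_id] at key
    simp_rw [hsol (hY Z hZ) ht,
      fun z => hsol (hY (fun _ => z) (@measurable_const _ _ _ (F t₀) z)) ht]
    exact key
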